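/- Let $\mathbb{F}$ be a field of characteristic zero and let $\mathbb{I}=\{0,1,2,3\}$. Let $\boxtimes$ be the tetrahedron algebra, that is, the Lie algebra over $\mathbb{F}$ with generators $x_{ij}$ ($i,j\in\mathbb{I}$, $i\neq j$) and the following relations: (i) $x_{ij}+x_{ji}=0$ for distinct $i,j\in\mathbb{I}$; (ii) $[x_{ij},x_{jk}]=2x_{ij}+2x_{jk}$ for mutually distinct $i,j,k\in\mathbb{I}$; (iii) $[x_{ij},[x_{ij},[x_{ij},x_{kh}]]]=4[x_{ij},x_{kh}]$ for mutually distinct $h,i,j,k\in\mathbb{I}$. For distinct $i,j\in\mathbb{I}$, let $X_{ij}$ be the set of all $x_{ij}$-like elements of $\boxtimes$, that is, the set of all $\xi\in\boxtimes$ such that $$[x_{ij},\xi]=0 \qquad\text{and}\qquad [x_{kh},[x_{kh},[x_{kh},\xi]]]=4[x_{kh},\xi],$$ where $\{h,k\}=\mathbb{I}\setminus\{i,j\}$ (the choice of the order of $h,k$ is immaterial, since $x_{hk}=-x_{kh}$). The set $X_{ij}$ is a linear subspace of $\boxtimes$. Then for all mutually distinct $h,i,j,k\in\mathbb{I}$,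 the vector space $\boxtimes$ is the direct sum of subspaces $$\boxtimes = X_{kh}\oplus X_{hi}\oplus X_{ij}.$$ -/

import Mathlib

noncomputable section

namespace Tetrahedron

/-- The index set of the standard generators: ordered pairs of distinct elements of
`{0, 1, 2, 3}`. -/
abbrev Gen : Type := {p : Fin 4 × Fin 4 // p.1 ≠ p.2}

section

variable (F : Type*) [Field F]

/-- The free generator with index `(i, j)`, in the free Lie algebra. -/
def freeGen (i j : Fin 4) (hij : i ≠ j) : FreeLieAlgebra F Gen :=
  FreeLieAlgebra.of F (⟨(i, j), hij⟩ : Gen)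

/-- The defining relators of the tetrahedron algebra. Each constructor is one of the three
families of relations, written as (left side) - (right side). -/
inductive IsRelator : FreeLieAlgebra F Gen → Prop
  | add_swap (i j : Fin 4) (hij : i ≠ j) :
      IsRelator (freeGen F i j hij + freeGen F j i hij.symm)
  | bracket (i j k : Fin 4) (hij : i ≠ j) (hjk : j ≠ k) (hik : i ≠ k) :
      IsRelator (⁅freeGen F i j hij, freeGen F j k hjk⁆ -
        ((2 : F) • freeGen F i j hij + (2 : F) • freeGen F j k hjk))
  | dolanGrady (h i j k : Fin 4) (hhi : h ≠ i) (hhj : h ≠ j) (hkh : k ≠ h)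
      (hij : i ≠ j) (hik : i ≠ k) (hjk : j ≠ k) :
      IsRelator (⁅freeGen F i j hij, ⁅freeGen F i j hij, ⁅freeGen F i j hij, freeGen F k h hkh⁆⁆⁆ -
        (4 : F) • ⁅freeGen F i j hij, freeGen F k h hkh⁆)

/-- The ideal of the free Lie algebra generated by the relators. -/
def relIdeal : LieIdeal F (FreeLieAlgebra F Gen) :=
  LieSubmodule.lieSpan F (FreeLieAlgebra F Gen) {r | IsRelator F r}

/-- The tetrahedron algebra over `F`. -/
def TetAlg : Type _ := FreeLieAlgebra F Gen ⧸ relIdeal F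

instance : LieRing (TetAlg F) :=
  inferInstanceAs (LieRing (FreeLieAlgebra F Gen ⧸ relIdeal F))

instance : LieAlgebra F (TetAlg F) :=
  inferInstanceAs (LieAlgebra F (FreeLieAlgebra F Gen ⧸ relIdeal F))

/-- The standard generator `x i j` of the tetrahedron algebra. -/
def x (i j : Fin 4) (hij : i ≠ j) : TetAlg F :=
  LieSubmodule.Quotient.mk (N := relIdeal F) (freeGen F i j hij)

/-- `ξ` is `x i j`-like: it commutes with `x i j`, and `x k h`, `ξ` satisfy the Dolan-Grady
relation, where `{h, k}` is the complement of `{i, j}`. Both orders of `h, k` are required; since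
`x k h = - x h k`, they give the same condition. -/
def IsLike (i j : Fin 4) (hij : i ≠ j) (ξ : TetAlg F) : Prop :=
  ⁅x F i j hij, ξ⁆ = 0 ∧
    ∀ (h k : Fin 4) (_ : h ≠ i) (_ : h ≠ j) (hkh : k ≠ h) (_ : k ≠ i) (_ : k ≠ j),
      ⁅x F k h hkh, ⁅x F k h hkh, ⁅x F k h hkh, ξ⁆⁆⁆ = (4 : F) • ⁅x F k h hkh, ξ⁆

/-- The subspace of `x i j`-like elements. -/
def X (i j : Fin 4) (hij : i ≠ j) : Submodule F (TetAlg F) where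
  carrier := {ξ | IsLike F i j hij ξ}
  zero_mem' := ⟨lie_zero _, fun h k _ _ _ _ _ => by simp only [lie_zero, smul_zero]⟩
  add_mem' := fun {a b} ha hb =>
    ⟨by rw [lie_add, ha.1, hb.1, add_zero], fun h k h1 h2 h3 h4 h5 => by
      simp only [lie_add, smul_add, ha.2 h k h1 h2 h3 h4 h5, hb.2 h k h1 h2 h3 h4 h5]⟩
  smul_mem' := fun c a ha =>
    ⟨by rw [lie_smul, ha.1, smul_zero], fun h k h1 h2 h3 h4 h5 => by
      simp only [lie_smul, ha.2 h k h1 h2 h3 h4 h5, smul_comm c (4 : F)]⟩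

end

end Tetrahedron

end

/-! The proof coordinatizes the algebra as sl₂ ⊗ J, with J a commutative algebra. The face k, h, i
gives an equitable basis g 0, g 1, g 2 of sl₂, each g i satisfying [g i, g (i + 1)] = 2 (g i + g (i
+ 1)). A triple in `adj F g` is an sl₂-map from the adjoint module; write g i ⊗ a for a i. If a and
b satisfy `Comm`, then [g i ⊗ a, g j ⊗ b] = [g i, g j] ⊗ ab defines the product `mul`.

The edge w i from the fourth vertex opposite to g i is g (i + 1) ⊗ T i + g (i + 2) ⊗ (T i - 1) for a
triple T i. The relations give T (i + 1) · T i = T i - 1, as for t, 1 - 1/t and 1/(1 - t). The main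
work is to show that all powers of the T i commute in the sense of `Comm`: `powComm` treats one T i
and `mixedComm` two of them, with products expanded in partial fractions. The span J of these powers
is then closed under `mul`, and the entries of J form a Lie subalgebra containing the generators,
hence everything.

Consequently ad (g i) has only the eigenvalues 0, 2, -2, the Dolan-Grady condition is automatic, and
X i j is the centralizer of x i j (`mem_X_iff`). In `IsFrame.centralizers`, the sum for a path of
three edges is direct because T i - 1 is invertible in J. -/

namespace Tetrahedron

/-! ### Triples of adjoint type over sl₂ and their product. -/

section AdjointTriples

variable {F : Type*} {L : Type*} [Field F] [LieRing L] [LieAlgebra F L]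

theorem fin3_one_one (i : Fin 3) : i + 1 + 1 = i + 2 := by fin_cases i <;> rfl
theorem fin3_one_two (i : Fin 3) : i + 1 + 2 = i := by fin_cases i <;> rfl
theorem fin3_two_one (i : Fin 3) : i + 2 + 1 = i := by fin_cases i <;> rfl
theorem fin3_two_two (i : Fin 3) : i + 2 + 2 = i + 1 := by fin_cases i <;> rfl

theorem fin3_forall {P : Fin 3 → Prop} (i : Fin 3) (h0 : P i) (h1 : P (i + 1)) (h2 : P (i + 2)) :
    ∀ j, P j := by
  intro j
  have : j = i ∨ j = i + 1 ∨ j = i + 2 := by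
    clear h0 h1 h2
    revert i j
    decide
  rcases this with rfl | rfl | rfl <;> assumption

variable (F) in
/-- The triples on which the elements `g 0, g 1, g 2` act in the same way as on the equitable
basis of `sl₂`. -/
def adj (g : Fin 3 → L) : Submodule F (Fin 3 → L) where
  carrier := {a | ∀ i, ⁅g i, a i⁆ = 0 ∧ ⁅g i, a (i + 1)⁆ = (2 : F) • (a i + a (i + 1)) ∧
    ⁅g i, a (i + 2)⁆ = -((2 : F) • (a (i + 2) + a i))}
  zero_mem' := fun i => by simp
  add_mem' := fun {a b} ha hb i => by
    obtain ⟨h1, h2, h3⟩ := ha i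
    obtain ⟨k1, k2, k3⟩ := hb i
    simp only [Pi.add_apply, lie_add, h1, h2, h3, k1, k2, k3]
    refine ⟨by simp, by module, by module⟩
  smul_mem' := fun c a ha i => by
    obtain ⟨h1, h2, h3⟩ := ha i
    simp only [Pi.smul_apply, lie_smul, h1, h2, h3]
    refine ⟨by simp, by module, by module⟩

variable {g a b c : Fin 3 → L}

theorem adj_zero (ha : a ∈ adj F g) (i : Fin 3) : ⁅g i, a i⁆ = 0 := (ha i).1

theorem adj_one (ha : a ∈ adj F g) (i : Fin 3) :
    ⁅g i, a (i + 1)⁆ = (2 : F) • (a i + a (i + 1)) := (ha i).2.1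

theorem adj_two (ha : a ∈ adj F g) (i : Fin 3) :
    ⁅g i, a (i + 2)⁆ = -((2 : F) • (a (i + 2) + a i)) := (ha i).2.2

theorem adj_one_zero (ha : a ∈ adj F g) (i : Fin 3) :
    ⁅g (i + 1), a i⁆ = -((2 : F) • (a i + a (i + 1))) := by
  simpa only [fin3_one_two] using adj_two ha (i + 1)

theorem adj_one_two (ha : a ∈ adj F g) (i : Fin 3) :
    ⁅g (i + 1), a (i + 2)⁆ = (2 : F) • (a (i + 1) + a (i + 2)) := by
  simpa only [fin3_one_one] using adj_one ha (i + 1)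

theorem adj_two_zero (ha : a ∈ adj F g) (i : Fin 3) :
    ⁅g (i + 2), a i⁆ = (2 : F) • (a (i + 2) + a i) := by
  simpa only [fin3_two_one] using adj_one ha (i + 2)

theorem adj_two_one (ha : a ∈ adj F g) (i : Fin 3) :
    ⁅g (i + 2), a (i + 1)⁆ = -((2 : F) • (a (i + 1) + a (i + 2))) := by
  simpa only [fin3_two_two] using adj_two ha (i + 2)

theorem lie_add_add (ha : a ∈ adj F g) (hb : b ∈ adj F g) (hc : c ∈ adj F g)
    (i : Fin 3) : ⁅g i, a i + b (i + 1) + c (i + 2)⁆ =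
      (2 : F) • (b i + b (i + 1)) - (2 : F) • (c (i + 2) + c i) := by
  rw [lie_add, lie_add, adj_zero ha, adj_one hb, adj_two hc]
  module

theorem lie_lie_add_add (ha : a ∈ adj F g) (hb : b ∈ adj F g)
    (hc : c ∈ adj F g) (i : Fin 3) : ⁅g i, ⁅g i, a i + b (i + 1) + c (i + 2)⁆⁆ =
      (4 : F) • (b i + b (i + 1)) + (4 : F) • (c (i + 2) + c i) := by
  rw [lie_add_add ha hb hc]
  simp only [lie_sub, lie_smul, lie_add, adj_zero hb, adj_one hb, adj_zero hc, adj_two hc]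
  module

/-- A triple is determined by one of its components. -/
theorem adj_ext (ha : a ∈ adj F g) (hb : b ∈ adj F g) [CharZero F] (i : Fin 3)
    (h : a i = b i) : a = b := by
  have h1 : a (i + 1) = b (i + 1) := by
    have e : ⁅g (i + 1), a i⁆ = ⁅g (i + 1), b i⁆ := by rw [h]
    rw [adj_one_zero ha, adj_one_zero hb] at e
    linear_combination (norm := module) (-1 / 2 : F) • e - h
  have h2 : a (i + 2) = b (i + 2) := by
    have e : ⁅g (i + 2), a i⁆ = ⁅g (i + 2), b i⁆ := by rw [h]
    rw [adj_two_zero ha, adj_two_zero hb] at e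
    linear_combination (norm := module) (1 / 2 : F) • e - h
  funext j
  exact fin3_forall (P := fun j => a j = b j) i h h1 h2 j

/-- Corresponding entries of the two triples commute. -/
def Comm (a b : Fin 3 → L) : Prop := ∀ i, ⁅a i, b i⁆ = 0

theorem Comm.symm (h : Comm a b) : Comm b a := fun i => by rw [← lie_skew, h i, neg_zero]

theorem Comm.refl (a : Fin 3 → L) : Comm a a := fun _ => lie_self _

theorem comm_one (ha : a ∈ adj F g) : Comm g a := adj_zero ha

variable (F) in
/-- The triples that commute with `a`. -/
def commSubmodule (a : Fin 3 → L) : Submodule F (Fin 3 → L) where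
  carrier := {b | Comm a b}
  zero_mem' := fun i => by simp
  add_mem' := fun {b c} hb hc i => by simp [hb i, hc i]
  smul_mem' := fun r b hb i => by simp [hb i]

/-- Apply ad g (i + 1) to the vanishing bracket. A second application, in `lie_succ_eq_zero`, moves
both factors to index i + 1. -/
theorem lie_skew_succ_of_lie_eq_zero [CharZero F] (ha : a ∈ adj F g) (hb : b ∈ adj F g) (i : Fin 3)
    (h : ⁅a i, b i⁆ = 0) : ⁅a i, b (i + 1)⁆ + ⁅a (i + 1), b i⁆ = 0 := by
  have e : ⁅g (i + 1), ⁅a i, b i⁆⁆ = 0 := by rw [h, lie_zero]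
  rw [leibniz_lie, adj_one_zero ha, adj_one_zero hb] at e
  simp only [lie_add, add_lie, lie_smul, smul_lie, lie_neg, neg_lie] at e
  linear_combination (norm := module) (-1 / 2 : F) • e - (2 : F) • h

theorem lie_succ_eq_zero [CharZero F] (ha : a ∈ adj F g) (hb : b ∈ adj F g) (i : Fin 3)
    (h : ⁅a i, b i⁆ = 0) : ⁅a (i + 1), b (i + 1)⁆ = 0 := by
  have h' := lie_skew_succ_of_lie_eq_zero ha hb i h
  have e : ⁅g (i + 1), ⁅a i, b (i + 1)⁆ + ⁅a (i + 1), b i⁆⁆ = 0 := by rw [h', lie_zero]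
  rw [lie_add, leibniz_lie _ (a i), leibniz_lie _ (a (i + 1)), adj_one_zero ha, adj_one_zero hb, adj_zero ha,
    adj_zero hb] at e
  simp only [lie_add, add_lie, lie_smul, smul_lie, lie_neg, neg_lie, lie_zero, zero_lie] at e
  linear_combination (norm := module) (-1 / 4 : F) • e - (1 / 2 : F) • h'

theorem comm_of_lie_eq_zero [CharZero F] (ha : a ∈ adj F g) (hb : b ∈ adj F g) (i : Fin 3)
    (h : ⁅a i, b i⁆ = 0) : Comm a b := by
  have h1 := lie_succ_eq_zero ha hb i h
  have h2 := lie_succ_eq_zero ha hb (i + 1) h1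
  rw [fin3_one_one] at h2
  exact fin3_forall (P := fun j => ⁅a j, b j⁆ = 0) i h h1 h2

theorem Comm.skew [CharZero F] (ha : a ∈ adj F g) (hb : b ∈ adj F g) (h : Comm a b) (i : Fin 3) :
    ⁅a (i + 1), b i⁆ = -⁅a i, b (i + 1)⁆ := by
  linear_combination (norm := module) lie_skew_succ_of_lie_eq_zero ha hb i (h i)

variable (F) in
/-- The product of the coefficients of two triples. -/
def mul : (Fin 3 → L) →ₗ[F] (Fin 3 → L) →ₗ[F] (Fin 3 → L) :=
  LinearMap.mk₂ F
    -- In sl₂ this combination of brackets of the g's equals 4 g i, so for commuting coefficients it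
    -- yields g i ⊗ ab.
    (fun a b i => (1 / 4 : F) • (⁅a i, b (i + 1)⁆ + ⁅a (i + 2), b i⁆ - ⁅a (i + 1), b (i + 2)⁆))
    (fun a a' b => by
      funext i; simp only [Pi.add_apply, add_lie]; module)
    (fun r a b => by
      funext i; simp only [Pi.smul_apply, smul_lie]; module)
    (fun a b b' => by
      funext i; simp only [Pi.add_apply, lie_add]; module)
    (fun r a b => by
      funext i; simp only [Pi.smul_apply, lie_smul]; module)

theorem mul_apply (a b : Fin 3 → L) (i : Fin 3) : mul F a b i =
    (1 / 4 : F) • (⁅a i, b (i + 1)⁆ + ⁅a (i + 2), b i⁆ - ⁅a (i + 1), b (i + 2)⁆) := rfl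

theorem lie_succ [CharZero F] (a b : Fin 3 → L) (i : Fin 3) :
    ⁅a i, b (i + 1)⁆ = (2 : F) • (mul F a b i + mul F a b (i + 1)) := by
  simp only [mul_apply, fin3_one_one, fin3_one_two]
  module

theorem mul_comm_of_comm [CharZero F] (ha : a ∈ adj F g) (hb : b ∈ adj F g) (h : Comm a b) :
    mul F a b = mul F b a := by
  funext i
  have h0 := h.symm.skew hb ha i
  have h1 := h.symm.skew hb ha (i + 1)
  have h2 := h.symm.skew hb ha (i + 2)
  simp only [fin3_one_one, fin3_two_one] at h0 h1 h2
  have e0 := lie_skew (a i) (b (i + 1))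
  have e1 := lie_skew (a (i + 1)) (b (i + 2))
  have e2 := lie_skew (a (i + 2)) (b i)
  simp only [mul_apply]
  rw [← e0, ← e1, ← e2, h0, h1, h2]
  module

theorem mul_mem_adj [CharZero F] (ha : a ∈ adj F g) (hb : b ∈ adj F g) (h : Comm a b) :
    mul F a b ∈ adj F g := by
  intro i
  have s0 := h.skew ha hb i
  have s2 := h.skew ha hb (i + 2)
  simp only [fin3_two_one] at s2
  simp only [mul_apply, fin3_one_one, fin3_one_two, fin3_two_one, fin3_two_two]
  simp only [lie_add, lie_sub, lie_smul, leibniz_lie (g i), adj_zero ha, adj_zero hb, adj_one ha,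
    adj_one hb, adj_two ha, adj_two hb, add_lie, smul_lie, lie_neg, neg_lie, zero_lie, lie_zero, s0, s2, h i]
  refine ⟨by module, by module, by module⟩

theorem one_mul_of_mem [CharZero F] (ha : a ∈ adj F g) : mul F g a = a := by
  funext i
  rw [mul_apply, adj_one ha, adj_two_zero ha, adj_one_two ha]
  module

theorem mul_one_of_mem [CharZero F] (hg : g ∈ adj F g) (ha : a ∈ adj F g) : mul F a g = a := by
  rw [mul_comm_of_comm ha hg (comm_one ha).symm, one_mul_of_mem ha]

/-- Relative to g i, the elements e = g i + g (i + 1) and f = g (i + 2) + g i are weight vectors of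
weights 2 and -2, and [e, f] = -4 g i. The bracket here is [e ⊗ a, f ⊗ b]. -/
theorem lie_nilp_nilp [CharZero F] (ha : a ∈ adj F g) (hb : b ∈ adj F g) (h : Comm a b)
    (i : Fin 3) : ⁅a i + a (i + 1), b (i + 2) + b i⁆ = (-4 : F) • mul F a b i := by
  have s0 := h.skew ha hb i
  have s2 := h.skew ha hb (i + 2)
  simp only [fin3_two_one] at s2
  rw [mul_apply]
  simp only [lie_add, add_lie, h i, s0, s2]
  module

theorem lie_nilp_left [CharZero F] (ha : a ∈ adj F g) (hb : b ∈ adj F g) (h : Comm a b)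
    (i : Fin 3) : ⁅a i + a (i + 1), b i⁆ = (-2 : F) • (mul F a b i + mul F a b (i + 1)) := by
  rw [add_lie, h i, h.skew ha hb i, lie_succ (F := F)]
  module

theorem lie_nilp_right [CharZero F] (h : Comm a b)
    (i : Fin 3) : ⁅a (i + 2) + a i, b i⁆ = (2 : F) • (mul F a b (i + 2) + mul F a b i) := by
  have := lie_succ (F := F) a b (i + 2)
  rw [fin3_two_one] at this
  rw [add_lie, h i, this]
  module

/-- If a mixed bracket of nilpotent entries is again an entry of a triple then the two triples
commute. -/
theorem comm_of_lie_nilp [CharZero F] (hg : g ∈ adj F g) (ha : a ∈ adj F g) (hb : b ∈ adj F g)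
    (hc : c ∈ adj F g) (i : Fin 3)
    (h : ⁅a i + a (i + 1), b (i + 2) + b i⁆ = (-4 : F) • c i) : Comm a b := by
  have nn : ∀ {u : Fin 3 → L}, u ∈ adj F g →
      ⁅g i + g (i + 1), u (i + 2) + u i⁆ = (-4 : F) • u i := fun hu => by
    rw [lie_nilp_nilp hg hu (comm_one hu), one_mul_of_mem hu]
  have nz : ∀ {u : Fin 3 → L}, u ∈ adj F g →
      ⁅g i + g (i + 1), u i⁆ = (-2 : F) • (u i + u (i + 1)) := fun hu => by
    rw [lie_nilp_left hg hu (comm_one hu), one_mul_of_mem hu]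
  have mz : ∀ {u : Fin 3 → L}, u ∈ adj F g →
      ⁅g (i + 2) + g i, u i⁆ = (2 : F) • (u (i + 2) + u i) := fun hu => by
    rw [lie_nilp_right (F := F) (comm_one hu), one_mul_of_mem hu]
  have n1 : ∀ {u : Fin 3 → L}, u ∈ adj F g → ⁅g i + g (i + 1), u i + u (i + 1)⁆ = 0 := fun hu => by
    simp only [lie_add, add_lie, adj_zero hu, adj_one hu, adj_one_zero hu]
    module
  have mn : ∀ {u : Fin 3 → L}, u ∈ adj F g →
      ⁅g (i + 2) + g i, u i + u (i + 1)⁆ = (4 : F) • u i := fun hu => by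
    simp only [lie_add, add_lie, adj_zero hu, adj_one hu, adj_two_zero hu, adj_two_one hu]
    module
  -- Applying ad e to the hypothesis, then ad f to the result, isolates [a i, b i].
  have e1 : ⁅a i + a (i + 1), b i⁆ = (-2 : F) • (c i + c (i + 1)) := by
    have e : ⁅g i + g (i + 1), ⁅a i + a (i + 1), b (i + 2) + b i⁆⁆ =
        ⁅g i + g (i + 1), (-4 : F) • c i⁆ := by rw [h]
    rw [leibniz_lie, n1 ha, nn hb, lie_smul, lie_smul, nz hc, zero_lie] at e
    linear_combination (norm := module) (-1 / 4 : F) • e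
  have e : ⁅g (i + 2) + g i, ⁅a i + a (i + 1), b i⁆⁆ =
      ⁅g (i + 2) + g i, (-2 : F) • (c i + c (i + 1))⁆ := by rw [e1]
  rw [leibniz_lie, mn ha, mz hb, lie_smul, lie_smul, mn hc, smul_lie, h] at e
  refine comm_of_lie_eq_zero ha hb i ?_
  linear_combination (norm := module) (1 / 4 : F) • e

/-- Write -4 (ab) i as [e ⊗ a, f ⊗ b] and use the Jacobi identity with c i. -/
theorem neg_four_smul_lie_mul [CharZero F] (ha : a ∈ adj F g) (hb : b ∈ adj F g)
    (hc : c ∈ adj F g) (hab : Comm a b) (hac : Comm a c) (hbc : Comm b c) (i : Fin 3) :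
    (-4 : F) • ⁅mul F a b i, c i⁆ =
      (2 : F) • ⁅a i + a (i + 1), mul F b c (i + 2) + mul F b c i⁆ -
      (2 : F) • ⁅mul F a c i + mul F a c (i + 1), b (i + 2) + b i⁆ := by
  rw [← smul_lie, ← lie_nilp_nilp ha hb hab, lie_lie, lie_nilp_right (F := F) hbc,
    lie_nilp_left ha hc hac, lie_smul, lie_smul, ← lie_skew (b (i + 2) + b i)]
  module

/-- By Jacobi, [(ab) 0, c 0] is a multiple of a(bc) - b(ac). The former is symmetric in a and b and
the latter antisymmetric, so both vanish. The same identity with b and c exchanged then gives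
associativity. -/
theorem Comm.mul_comm_and_assoc [CharZero F] (ha : a ∈ adj F g) (hb : b ∈ adj F g)
    (hc : c ∈ adj F g) (hab : Comm a b) (hac : Comm a c) (hbc : Comm b c)
    (h1 : Comm a (mul F b c)) (h2 : Comm b (mul F a c)) :
    Comm (mul F a b) c ∧ mul F (mul F a b) c = mul F a (mul F b c) := by
  have key : ∀ {a b c : Fin 3 → L}, a ∈ adj F g → b ∈ adj F g → c ∈ adj F g → Comm a b →
      Comm a c → Comm b c → Comm a (mul F b c) → Comm b (mul F a c) →
      (-4 : F) • ⁅mul F a b 0, c 0⁆ =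
        (-8 : F) • mul F a (mul F b c) 0 + (8 : F) • mul F b (mul F a c) 0 := by
    intro a b c ha hb hc hab hac hbc h1 h2
    have mbc := mul_mem_adj hb hc hbc
    have mac := mul_mem_adj ha hc hac
    rw [neg_four_smul_lie_mul ha hb hc hab hac hbc, lie_nilp_nilp ha mbc h1,
      lie_nilp_nilp mac hb h2.symm, mul_comm_of_comm mac hb h2.symm]
    module
  have k1 := key ha hb hc hab hac hbc h1 h2
  have k2 := key hb ha hc hab.symm hbc hac h2 h1
  rw [mul_comm_of_comm hb ha hab.symm] at k2
  have mab := mul_mem_adj ha hb hab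
  have mbc := mul_mem_adj hb hc hbc
  have h3 : Comm (mul F a b) c := by
    refine comm_of_lie_eq_zero mab hc 0 ?_
    linear_combination (norm := module) (-1 / 8 : F) • (k1 + k2)
  have e := mul_comm_of_comm hb hc hbc
  have k3 := key ha hc hb hac hab hbc.symm (e ▸ h1) h3.symm
  refine ⟨h3, ?_⟩
  rw [mul_comm_of_comm mab hc h3]
  refine adj_ext (mul_mem_adj hc mab h3.symm) (mul_mem_adj ha mbc h1) 0 ?_
  rw [h2.symm 0, ← e] at k3
  linear_combination (norm := module) (-1 / 8 : F) • k3

end AdjointTriples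

/-! ### Powers of a single triple commute. -/

section Powers

variable {F : Type*} {L : Type*} [Field F] [LieRing L] [LieAlgebra F L]
variable {g a b c t : Fin 3 → L}

variable (F) in
/-- The powers of the triple `t`, where `g` plays the role of one. -/
def pow (g t : Fin 3 → L) : ℕ → Fin 3 → L
  | 0 => g
  | n + 1 => mul F t (pow g t n)

theorem pow_zero' (g t : Fin 3 → L) : pow F g t 0 = g := rfl

theorem pow_succ' (g t : Fin 3 → L) (n : ℕ) : pow F g t (n + 1) = mul F t (pow F g t n) := rfl

variable (F) in
/-- The powers of `t` up to total degree `N` commute and multiply as they should. -/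
def PowComm (g t : Fin 3 → L) (N : ℕ) : Prop :=
  (∀ n ≤ N, pow F g t n ∈ adj F g) ∧ ∀ m n, m + n ≤ N →
    Comm (pow F g t m) (pow F g t n) ∧ mul F (pow F g t m) (pow F g t n) = pow F g t (m + n)

theorem PowComm.mono {M N : ℕ} (h : PowComm F g t N) (hMN : M ≤ N) : PowComm F g t M :=
  ⟨fun n hn => h.1 n (hn.trans hMN), fun m n hmn => h.2 m n (hmn.trans hMN)⟩

variable [CharZero F]

theorem pow_one' (hg : g ∈ adj F g) (ht : t ∈ adj F g) : pow F g t 1 = t :=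
  mul_one_of_mem hg ht

theorem lie_nilp_nilp_eq_zero (ha : a ∈ adj F g) (hb : b ∈ adj F g) (h : Comm a b) (i : Fin 3) :
    ⁅a (i + 2) + a i, b (i + 2) + b i⁆ = 0 := by
  have s2 := h.skew ha hb (i + 2)
  simp only [fin3_two_one] at s2
  simp only [lie_add, add_lie, h i, h (i + 2), s2]
  module

/-- Here f ⊗ ab is half of [f ⊗ b, a i], and f ⊗ b commutes with f ⊗ c, so Jacobi lets b and c
change places. -/
theorem lie_nilp_mul_comm (ha : a ∈ adj F g) (hb : b ∈ adj F g) (hc : c ∈ adj F g)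
    (hab : Comm a b) (hac : Comm a c) (hbc : Comm b c) (i : Fin 3) :
    ⁅mul F a b (i + 2) + mul F a b i, c (i + 2) + c i⁆ =
      ⁅mul F a c (i + 2) + mul F a c i, b (i + 2) + b i⁆ := by
  have e : ⁅⁅b (i + 2) + b i, a i⁆, c (i + 2) + c i⁆ =
      -⁅b (i + 2) + b i, ⁅c (i + 2) + c i, a i⁆⁆ := by
    rw [lie_lie, lie_nilp_nilp_eq_zero hb hc hbc, lie_zero, ← lie_skew (a i), lie_neg, sub_zero]
  rw [lie_nilp_right (F := F) hab.symm, lie_nilp_right (F := F) hac.symm, smul_lie, lie_smul,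
    ← lie_skew (b (i + 2) + b i), mul_comm_of_comm hb ha hab.symm,
    mul_comm_of_comm hc ha hac.symm] at e
  linear_combination (norm := module) (1 / 2 : F) • e

/-- Apply ad e twice to [f ⊗ a, f ⊗ b] = 0. -/
theorem lie_nilp_sub_lie_nilp (hg : g ∈ adj F g) (ha : a ∈ adj F g) (hb : b ∈ adj F g) (i : Fin 3)
    (h : ⁅a (i + 2) + a i, b (i + 2) + b i⁆ = 0) :
    ⁅b i + b (i + 1), a (i + 2) + a i⁆ - ⁅a i + a (i + 1), b (i + 2) + b i⁆ =
      (4 : F) • ⁅a i, b i⁆ := by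
  have nn : ∀ {u : Fin 3 → L}, u ∈ adj F g →
      ⁅g i + g (i + 1), u (i + 2) + u i⁆ = (-4 : F) • u i := fun hu => by
    rw [lie_nilp_nilp hg hu (comm_one hu), one_mul_of_mem hu]
  have nz : ∀ {u : Fin 3 → L}, u ∈ adj F g →
      ⁅g i + g (i + 1), u i⁆ = (-2 : F) • (u i + u (i + 1)) := fun hu => by
    rw [lie_nilp_left hg hu (comm_one hu), one_mul_of_mem hu]
  have e1 : ⁅a i, b (i + 2) + b i⁆ + ⁅a (i + 2) + a i, b i⁆ = 0 := by
    have e : ⁅g i + g (i + 1), ⁅a (i + 2) + a i, b (i + 2) + b i⁆⁆ = 0 := by rw [h, lie_zero]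
    rw [leibniz_lie, nn ha, nn hb, smul_lie, lie_smul] at e
    linear_combination (norm := module) (-1 / 4 : F) • e
  have e : ⁅g i + g (i + 1), ⁅a i, b (i + 2) + b i⁆⁆ +
      ⁅g i + g (i + 1), ⁅a (i + 2) + a i, b i⁆⁆ = 0 := by rw [← lie_add, e1, lie_zero]
  rw [leibniz_lie _ (a i), leibniz_lie _ (a (i + 2) + a i), nn ha, nn hb, nz ha, nz hb, smul_lie,
    lie_smul, smul_lie, lie_smul, ← lie_skew (a (i + 2) + a i)] at e
  linear_combination (norm := module) (1 / 2 : F) • e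

/-- A cocycle identity for the bracket of equal entries, which measures the failure of `Comm`.
Averaging `neg_four_smul_lie_mul` over the exchange of a and b leaves differences covered by
`lie_nilp_sub_lie_nilp`. -/
theorem lie_mul_eq_add (hg : g ∈ adj F g) (ha : a ∈ adj F g) (hb : b ∈ adj F g)
    (hc : c ∈ adj F g) (hab : Comm a b) (hac : Comm a c) (hbc : Comm b c) (i : Fin 3)
    (h1 : ⁅a (i + 2) + a i, mul F b c (i + 2) + mul F b c i⁆ = 0)
    (h2 : ⁅b (i + 2) + b i, mul F a c (i + 2) + mul F a c i⁆ = 0) :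
    ⁅mul F a b i, c i⁆ = ⁅a i, mul F b c i⁆ + ⁅b i, mul F a c i⁆ := by
  have k1 := neg_four_smul_lie_mul ha hb hc hab hac hbc i
  have k2 := neg_four_smul_lie_mul hb ha hc hab.symm hbc hac i
  rw [mul_comm_of_comm hb ha hab.symm] at k2
  have e1 := lie_nilp_sub_lie_nilp hg ha (mul_mem_adj hb hc hbc) i h1
  have e2 := lie_nilp_sub_lie_nilp hg hb (mul_mem_adj ha hc hac) i h2
  linear_combination (norm := module)
    (-1 / 8 : F) • (k1 + k2) + (1 / 4 : F) • (e1 + e2)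

theorem PowComm.lie_nilp_eq_zero (hg : g ∈ adj F g) (ht : t ∈ adj F g) (k : Fin 3)
    (hk : ⁅mul F t t (k + 2) + mul F t t k, t (k + 2) + t k⁆ = 0) {N : ℕ} (hN : 2 ≤ N)
    (H : PowComm F g t N) (m n : ℕ) (hm : 1 ≤ m) (hn : 1 ≤ n) (hmn : m + n = N + 1) :
    ⁅pow F g t m (k + 2) + pow F g t m k, pow F g t n (k + 2) + pow F g t n k⁆ = 0 := by
  have p1 := pow_one' (F := F) hg ht
  rcases hN.eq_or_lt with rfl | hN
  · have : (m = 2 ∧ n = 1) ∨ (m = 1 ∧ n = 2) := by omega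
    rcases this with ⟨rfl, rfl⟩ | ⟨rfl, rfl⟩
    · rw [pow_succ' g t 1, p1]
      exact hk
    · rw [pow_succ' g t 1, p1, ← lie_skew, hk, neg_zero]
  have shift : ∀ m n, 2 ≤ m → 1 ≤ n → m + n = N + 1 →
      ⁅pow F g t m (k + 2) + pow F g t m k, pow F g t n (k + 2) + pow F g t n k⁆ =
      ⁅pow F g t N (k + 2) + pow F g t N k, pow F g t 1 (k + 2) + pow F g t 1 k⁆ := by
    intro m n hm hn hmn
    rcases hn.eq_or_lt with rfl | hn
    · obtain rfl : m = N := by omega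
      rfl
    obtain ⟨i, rfl⟩ : ∃ i, m = i + 1 := ⟨m - 1, by omega⟩
    have e := lie_nilp_mul_comm (H.1 i (by omega)) (H.1 1 (by omega)) (H.1 n (by omega))
      (H.2 i 1 (by omega)).1 (H.2 i n (by omega)).1 (H.2 1 n (by omega)).1 k
    rw [(H.2 i 1 (by omega)).2, (H.2 i n (by omega)).2, show i + n = N by omega] at e
    exact e
  -- The exponents (2, N - 1) and (N - 1, 2) give the same value by `shift` and opposite values by
  -- antisymmetry. This needs N - 1 ≥ 2, so N = 2 rests on `hk`.
  have z : ⁅pow F g t N (k + 2) + pow F g t N k, pow F g t 1 (k + 2) + pow F g t 1 k⁆ = 0 := by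
    have e1 := shift 2 (N - 1) le_rfl (by omega) (by omega)
    have e2 := shift (N - 1) 2 (by omega) (by omega) (by omega)
    rw [← lie_skew, e2] at e1
    linear_combination (norm := module) (-1 / 2 : F) • e1
  rcases hm.eq_or_lt with rfl | hm
  · obtain rfl : n = N := by omega
    rw [← lie_skew, z, neg_zero]
  · rw [shift m n hm hn hmn, z]

/-- In total degree N + 1 the cocycle identity makes the bracket of the i-th and j-th powers equal
to -i times that of the N-th and first. Taking i = N shows that N + 1 kills the latter, and
characteristic zero finishes. -/
theorem PowComm.comm (hg : g ∈ adj F g) (ht : t ∈ adj F g) (k : Fin 3)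
    (hk : ⁅mul F t t (k + 2) + mul F t t k, t (k + 2) + t k⁆ = 0) {N : ℕ} (hN : 2 ≤ N)
    (H : PowComm F g t N) (m n : ℕ) (hm : 1 ≤ m) (hn : 1 ≤ n) (hmn : m + n = N + 1) :
    Comm (pow F g t m) (pow F g t n) := by
  have z := H.lie_nilp_eq_zero hg ht k hk hN
  have cyc : ∀ i j, 1 ≤ i → 1 ≤ j → i + j = N → ⁅pow F g t N k, pow F g t 1 k⁆ =
      ⁅pow F g t i k, pow F g t (j + 1) k⁆ + ⁅pow F g t j k, pow F g t (i + 1) k⁆ := by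
    intro i j hi hj hij
    have e := lie_mul_eq_add hg (H.1 i (by omega)) (H.1 j (by omega)) (H.1 1 (by omega))
      (H.2 i j (by omega)).1 (H.2 i 1 (by omega)).1 (H.2 j 1 (by omega)).1 k
    rw [(H.2 i j (by omega)).2, (H.2 i 1 (by omega)).2, (H.2 j 1 (by omega)).2, hij] at e
    exact e (z i (j + 1) hi (by omega) (by omega)) (z j (i + 1) hj (by omega) (by omega))
  have lin : ∀ i, 1 ≤ i → ∀ j, 1 ≤ j → i + j = N + 1 → ⁅pow F g t i k, pow F g t j k⁆ =
      (-(i : F)) • ⁅pow F g t N k, pow F g t 1 k⁆ := by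
    intro i hi
    induction i, hi using Nat.le_induction with
    | base =>
      intro j hj hij
      obtain rfl : j = N := by omega
      rw [← lie_skew]
      module
    | succ i hi ih =>
      intro j hj hij
      have e1 := ih (j + 1) (by omega) (by omega)
      have e2 := cyc i j hi hj (by omega)
      rw [e1, ← lie_skew (pow F g t j k)] at e2
      push_cast
      linear_combination (norm := module) e2
  have e := lin N (by omega) 1 le_rfl rfl
  have e' : ((N : F) + 1) • ⁅pow F g t N k, pow F g t 1 k⁆ = 0 := by
    linear_combination (norm := module) e
  have e0 := (smul_eq_zero.mp e').resolve_left (by exact_mod_cast N.succ_ne_zero)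
  refine comm_of_lie_eq_zero (H.1 m (by omega)) (H.1 n (by omega)) k ?_
  rw [lin m hm n hn hmn, e0, smul_zero]

theorem powComm_two (hg : g ∈ adj F g) (ht : t ∈ adj F g) : PowComm F g t 2 := by
  have p1 := pow_one' (F := F) hg ht
  have mem : ∀ n ≤ 2, pow F g t n ∈ adj F g := by
    intro n hn
    interval_cases n
    · exact hg
    · rwa [p1]
    · rw [pow_succ' g t 1, p1]
      exact mul_mem_adj ht ht (Comm.refl t)
  refine ⟨mem, fun m n hmn => ?_⟩
  rcases Nat.eq_zero_or_pos m with rfl | hm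
  · rw [zero_add]
    exact ⟨comm_one (mem n (by omega)), one_mul_of_mem (mem n (by omega))⟩
  rcases Nat.eq_zero_or_pos n with rfl | hn
  · exact ⟨(comm_one (mem m (by omega))).symm, mul_one_of_mem hg (mem m (by omega))⟩
  obtain ⟨rfl, rfl⟩ : m = 1 ∧ n = 1 := by omega
  refine ⟨Comm.refl _, ?_⟩
  rw [pow_succ' g t 1, p1]

theorem PowComm.succ (hg : g ∈ adj F g) (ht : t ∈ adj F g) (k : Fin 3)
    (hk : ⁅mul F t t (k + 2) + mul F t t k, t (k + 2) + t k⁆ = 0) {N : ℕ} (hN : 2 ≤ N)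
    (H : PowComm F g t N) : PowComm F g t (N + 1) := by
  have p1 := pow_one' (F := F) hg ht
  have hc := H.comm hg ht k hk hN
  have mem : ∀ n ≤ N + 1, pow F g t n ∈ adj F g := by
    intro n hn
    rcases hn.lt_or_eq with hn | rfl
    · exact H.1 n (by omega)
    · refine mul_mem_adj ht (H.1 N le_rfl) ?_
      have e := hc 1 N le_rfl (by omega) (by omega)
      rwa [p1] at e
  refine ⟨mem, fun m n hmn => ?_⟩
  rcases hmn.lt_or_eq with hmn | hmn
  · exact H.2 m n (by omega)
  rcases Nat.eq_zero_or_pos m with rfl | hm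
  · rw [zero_add]
    exact ⟨comm_one (mem n (by omega)), one_mul_of_mem (mem n (by omega))⟩
  rcases Nat.eq_zero_or_pos n with rfl | hn
  · exact ⟨(comm_one (mem m (by omega))).symm, mul_one_of_mem hg (mem m (by omega))⟩
  refine ⟨hc m n hm hn hmn, ?_⟩
  obtain ⟨i, rfl⟩ : ∃ i, m = i + 1 := ⟨m - 1, by omega⟩
  rcases Nat.eq_zero_or_pos i with rfl | hi
  · rw [p1, show 0 + 1 + n = n + 1 by omega, pow_succ']
  have q : ∀ n, mul F (pow F g t 1) (pow F g t n) = pow F g t (n + 1) := fun n => by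
    rw [p1, pow_succ']
  have e := (Comm.mul_comm_and_assoc (H.1 1 (by omega)) (H.1 i (by omega)) (H.1 n (by omega))
    (H.2 1 i (by omega)).1 (H.2 1 n (by omega)).1 (H.2 i n (by omega)).1
    (by rw [(H.2 i n (by omega)).2]; exact hc 1 (i + n) le_rfl (by omega) (by omega))
    (by rw [q]; exact hc i (n + 1) hi (by omega) (by omega))).2
  rw [q, (H.2 i n (by omega)).2, q] at e
  rw [e, show i + n + 1 = i + 1 + n by omega]

theorem powComm (hg : g ∈ adj F g) (ht : t ∈ adj F g) (k : Fin 3)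
    (hk : ⁅mul F t t (k + 2) + mul F t t k, t (k + 2) + t k⁆ = 0) (N : ℕ) : PowComm F g t N := by
  refine PowComm.mono (N := N + 2) ?_ (by omega)
  induction N with
  | zero => exact powComm_two hg ht
  | succ N ih => exact ih.succ hg ht k hk (by omega)

end Powers

/-! ### Mixed products, partial fractions and the coordinate algebra. -/

section CoordinateAlgebra

variable {F : Type*} {L : Type*} [Field F] [LieRing L] [LieAlgebra F L]
variable {g t s : Fin 3 → L}

variable (F) in
/-- The span of the powers of `t` of exponent at most `n`. -/
def powSpan (g t : Fin 3 → L) (n : ℕ) : Submodule F (Fin 3 → L) :=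
  Submodule.span F (pow F g t '' Set.Iic n)

theorem pow_mem_powSpan {m n : ℕ} (h : m ≤ n) : pow F g t m ∈ powSpan F g t n :=
  Submodule.subset_span ⟨m, h, rfl⟩

theorem powSpan_mono {m n : ℕ} (h : m ≤ n) : powSpan F g t m ≤ powSpan F g t n :=
  Submodule.span_mono (Set.image_mono (Set.Iic_subset_Iic.mpr h))

theorem powSpan_le {n : ℕ} {P : Submodule F (Fin 3 → L)} (h : ∀ m ≤ n, pow F g t m ∈ P) :
    powSpan F g t n ≤ P := by
  refine Submodule.span_le.mpr ?_
  rintro _ ⟨m, hm, rfl⟩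
  exact h m hm

variable (F) in
/-- The `m`-th power of `t` and the `n`-th power of `s` commute, and their product has a partial
fraction decomposition. -/
def MixedComm (g t s : Fin 3 → L) (m n : ℕ) : Prop :=
  Comm (pow F g t m) (pow F g s n) ∧
    mul F (pow F g t m) (pow F g s n) ∈ powSpan F g t m ⊔ powSpan F g s n

variable [CharZero F]

theorem MixedComm.symm (ht : ∀ N, PowComm F g t N) (hs : ∀ N, PowComm F g s N) {m n : ℕ}
    (h : MixedComm F g t s m n) : MixedComm F g s t n m := by
  refine ⟨h.1.symm, ?_⟩
  rw [sup_comm, mul_comm_of_comm ((hs n).1 n le_rfl) ((ht m).1 m le_rfl) h.1.symm]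
  exact h.2

/-- Apply `Comm.mul_comm_and_assoc` to t, tᵐ, sⁿ. Its mixed hypotheses hold because tᵐsⁿ and t sⁿ
are, by induction, combinations of pure powers already known to commute with t and tᵐ. -/
theorem mixedComm_succ (hg : g ∈ adj F g) (ht' : t ∈ adj F g) (ht : ∀ N, PowComm F g t N)
    (hs : ∀ N, PowComm F g s N)
    {m n : ℕ} (hm : 1 ≤ m)
    (IH : ∀ i j, i + j < m + 1 + n → MixedComm F g t s i j) : MixedComm F g t s (m + 1) n := by
  have p1 := pow_one' (F := F) hg ht'
  have hb := (ht m).1 m le_rfl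
  have hc := (hs n).1 n le_rfl
  have hac := IH 1 n (by omega)
  have hbc := IH m n (by omega)
  rw [MixedComm, p1] at hac
  have htt : ∀ i, Comm t (pow F g t i) := fun i => by
    have := ((ht (1 + i)).2 1 i le_rfl).1
    rwa [p1] at this
  have hts : ∀ j ≤ n, Comm t (pow F g s j) := fun j hj => by
    have := (IH 1 j (by omega)).1
    rwa [p1] at this
  have h1 : Comm t (mul F (pow F g t m) (pow F g s n)) := by
    have : powSpan F g t m ⊔ powSpan F g s n ≤ commSubmodule F t :=
      sup_le (powSpan_le fun i _ => htt i) (powSpan_le fun j hj => hts j hj)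
    exact this hbc.2
  have h2 : Comm (pow F g t m) (mul F t (pow F g s n)) := by
    have : powSpan F g t 1 ⊔ powSpan F g s n ≤ commSubmodule F (pow F g t m) :=
      sup_le (powSpan_le fun i _ => ((ht (m + i)).2 m i le_rfl).1)
        (powSpan_le fun j hj => (IH m j (by omega)).1)
    exact this hac.2
  obtain ⟨e1, e2⟩ := Comm.mul_comm_and_assoc ht' hb hc (htt m) hac.1 hbc.1 h1 h2
  refine ⟨e1, ?_⟩
  rw [pow_succ', e2]
  have : powSpan F g t m ⊔ powSpan F g s n ≤
      (powSpan F g t (m + 1) ⊔ powSpan F g s n).comap (mul F t) := by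
    refine sup_le (powSpan_le fun i hi => ?_) (powSpan_le fun j hj => ?_)
    · exact Submodule.mem_sup_left (pow_mem_powSpan (m := i + 1) (by omega))
    · have := (IH 1 j (by omega)).2
      rw [p1] at this
      exact SetLike.le_def.mp (sup_le_sup (powSpan_mono (by omega)) (powSpan_mono hj)) this
  exact this hbc.2

theorem mixedComm (hg : g ∈ adj F g) (ht' : t ∈ adj F g) (hs' : s ∈ adj F g)
    (ht : ∀ N, PowComm F g t N) (hs : ∀ N, PowComm F g s N) (hts : Comm t s)
    (hmul : mul F t s ∈ powSpan F g t 1 ⊔ powSpan F g s 1) (m n : ℕ) : MixedComm F g t s m n := by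
  suffices H : ∀ N m n, m + n < N → MixedComm F g t s m n from H _ m n (Nat.lt_succ_self _)
  intro N
  induction N with
  | zero => intro m n h; omega
  | succ N ih =>
    intro m n hmn
    have hmt := (ht m).1 m le_rfl
    have hns := (hs n).1 n le_rfl
    rcases Nat.eq_zero_or_pos m with rfl | hm
    · refine ⟨comm_one hns, ?_⟩
      rw [pow_zero', one_mul_of_mem hns]
      exact Submodule.mem_sup_right (pow_mem_powSpan le_rfl)
    rcases Nat.eq_zero_or_pos n with rfl | hn
    · refine ⟨(comm_one hmt).symm, ?_⟩
      rw [pow_zero', mul_one_of_mem hg hmt]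
      exact Submodule.mem_sup_left (pow_mem_powSpan le_rfl)
    by_cases hm2 : 2 ≤ m
    · obtain ⟨i, rfl⟩ : ∃ i, m = i + 1 := ⟨m - 1, by omega⟩
      exact mixedComm_succ hg ht' ht hs (by omega) fun i j hij => ih i j (by omega)
    by_cases hn2 : 2 ≤ n
    · obtain ⟨i, rfl⟩ : ∃ i, n = i + 1 := ⟨n - 1, by omega⟩
      exact (mixedComm_succ hg hs' hs ht (by omega)
        fun i j hij => (ih j i (by omega)).symm ht hs).symm hs ht
    obtain ⟨rfl, rfl⟩ : m = 1 ∧ n = 1 := by omega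
    rw [MixedComm, pow_one' hg ht', pow_one' hg hs']
    exact ⟨hts, hmul⟩

/-- `J` is a commutative associative algebra of triples, with identity `g`. -/
structure IsCoordAlgebra (g : Fin 3 → L) (J : Submodule F (Fin 3 → L)) : Prop where
  le : J ≤ adj F g
  one_mem : g ∈ J
  comm : ∀ a ∈ J, ∀ b ∈ J, Comm a b
  mul_mem : ∀ a ∈ J, ∀ b ∈ J, mul F a b ∈ J

/-- J is the span of the powers of the three T i. The relations are those of t, 1 - 1/t, 1/(1 - t),
so a product of powers of two different T i splits into partial fractions and stays in the span. -/
theorem exists_isCoordAlgebra (hg : g ∈ adj F g) {T : Fin 3 → Fin 3 → L}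
    (hT : ∀ i, T i ∈ adj F g) (hp : ∀ i N, PowComm F g (T i) N)
    (hc : ∀ i, Comm (T (i + 1)) (T i)) (hm : ∀ i, mul F (T (i + 1)) (T i) = T i - g) :
    ∃ J : Submodule F (Fin 3 → L), IsCoordAlgebra g J ∧ ∀ i, T i ∈ J := by
  have step : ∀ i m n, MixedComm F g (T (i + 1)) (T i) m n := fun i =>
    mixedComm hg (hT _) (hT _) (hp _) (hp _) (hc i) (by
      rw [hm]
      refine Submodule.mem_sup_right (Submodule.sub_mem _ ?_ (pow_mem_powSpan (m := 0) (by omega)))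
      have := pow_mem_powSpan (F := F) (g := g) (t := T i) (le_refl 1)
      rwa [pow_one' hg (hT i)] at this)
  have mixed : ∀ i j m n, Comm (pow F g (T i) m) (pow F g (T j) n) ∧
      mul F (pow F g (T i) m) (pow F g (T j) n) ∈
        Submodule.span F (Set.range fun p : Fin 3 × ℕ => pow F g (T p.1) p.2) := by
    intro i
    have le : ∀ i m, powSpan F g (T i) m ≤
        Submodule.span F (Set.range fun p : Fin 3 × ℕ => pow F g (T p.1) p.2) := fun i m =>
      powSpan_le fun l _ => Submodule.subset_span ⟨(i, l), rfl⟩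
    refine fin3_forall i (fun m n => ?_) (fun m n => ?_) (fun m n => ?_)
    · obtain ⟨h1, h2⟩ := (hp i (m + n)).2 m n le_rfl
      refine ⟨h1, ?_⟩
      rw [h2]
      exact Submodule.subset_span ⟨(i, m + n), rfl⟩
    · obtain ⟨h1, h2⟩ := (step i n m).symm (hp _) (hp _)
      exact ⟨h1, sup_le (le _ _) (le _ _) h2⟩
    · have := step (i + 2) m n
      rw [fin3_two_one] at this
      exact ⟨this.1, sup_le (le _ _) (le _ _) this.2⟩
  refine ⟨Submodule.span F (Set.range fun p : Fin 3 × ℕ => pow F g (T p.1) p.2),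
    ⟨?_, ?_, ?_, ?_⟩, ?_⟩
  · refine Submodule.span_le.mpr ?_
    rintro _ ⟨⟨i, m⟩, rfl⟩
    exact (hp i m).1 m le_rfl
  · exact Submodule.subset_span ⟨(0, 0), rfl⟩
  · intro a ha b hb
    induction ha, hb using Submodule.span_induction₂ with
    | mem_mem a b ha hb =>
      obtain ⟨⟨i, m⟩, rfl⟩ := ha
      obtain ⟨⟨j, n⟩, rfl⟩ := hb
      exact (mixed i j m n).1
    | zero_left b hb => exact ((commSubmodule F b).zero_mem : Comm b 0).symm
    | zero_right a ha => exact (commSubmodule F a).zero_mem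
    | add_left a a' b _ _ _ h h' => 
      exact (Submodule.add_mem (commSubmodule F b) h.symm h'.symm : Comm _ _).symm
    | add_right a b b' _ _ _ h h' => exact (Submodule.add_mem (commSubmodule F a) h h' : Comm _ _)
    | smul_left r a b _ _ h =>
      exact (Submodule.smul_mem (commSubmodule F b) r h.symm : Comm _ _).symm
    | smul_right r a b _ _ h => exact (Submodule.smul_mem (commSubmodule F a) r h : Comm _ _)
  · intro a ha b hb
    induction ha, hb using Submodule.span_induction₂ with
    | mem_mem a b ha hb =>
      obtain ⟨⟨i, m⟩, rfl⟩ := ha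
      obtain ⟨⟨j, n⟩, rfl⟩ := hb
      exact (mixed i j m n).2
    | zero_left b hb => simp
    | zero_right a ha => simp
    | add_left a a' b _ _ _ h h' => rw [map_add]; exact add_mem h h'
    | add_right a b b' _ _ _ h h' => rw [map_add]; exact add_mem h h'
    | smul_left r a b _ _ h => rw [map_smul]; exact Submodule.smul_mem _ r h
    | smul_right r a b _ _ h => rw [map_smul]; exact Submodule.smul_mem _ r h
  · intro i
    exact Submodule.subset_span ⟨(i, 1), pow_one' hg (hT i)⟩

end CoordinateAlgebra

/-! ### Coordinates of the edges at the fourth vertex. -/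

section Frames

variable {F : Type*} {L : Type*} [Field F] [LieRing L] [LieAlgebra F L]

variable (F) in
/-- The relations of the tetrahedron algebra, for a triangle of edges `g 0, g 1, g 2` and for the
edges `w i` from the fourth vertex such that `w i` is opposite to `g i`. -/
structure IsFrame (g w : Fin 3 → L) : Prop where
  lie_base : ∀ i, ⁅g i, g (i + 1)⁆ = (2 : F) • (g i + g (i + 1))
  lie_out : ∀ i, ⁅g (i + 1), w i⁆ = (2 : F) • (w i - g (i + 1))
  lie_in : ∀ i, ⁅g (i + 2), w i⁆ = -((2 : F) • (w i + g (i + 2)))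
  lie_apex : ∀ i, ⁅w (i + 1), w i⁆ = (2 : F) • (w (i + 1) - w i)
  dolanGrady : ∀ i, ⁅g i, ⁅g i, ⁅g i, w i⁆⁆⁆ = (4 : F) • ⁅g i, w i⁆
  dolanGrady_apex : ∀ i, ⁅w i, ⁅w i, ⁅w i, g i⁆⁆⁆ = (4 : F) • ⁅w i, g i⁆

variable (F) in
/-- The triple of components of `w i` with respect to the triangle `g`. -/
def frameTriple (g w : Fin 3 → L) (i j : Fin 3) : L :=
  -- These entries solve w i = T (i + 1) + T (i + 2) - g (i + 2) together with its images under ad g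
  -- i and its square, for T in `adj F g`.
  if j = i then (1 / 2 : F) • (g i - w i) + (1 / 8 : F) • ⁅g i, ⁅g i, w i⁆⁆
  else if j = i + 1 then (1 / 2 : F) • (w i - g i) + (1 / 4 : F) • ⁅g i, w i⁆
  else -((1 / 4 : F) • ⁅g i, w i⁆) + g (i + 2) + (1 / 2 : F) • (g i + w i)

variable {g w : Fin 3 → L}

theorem frameTriple_zero (i : Fin 3) : frameTriple F g w i i =
    (1 / 2 : F) • (g i - w i) + (1 / 8 : F) • ⁅g i, ⁅g i, w i⁆⁆ := if_pos rfl

theorem frameTriple_one (i : Fin 3) : frameTriple F g w i (i + 1) =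
    (1 / 2 : F) • (w i - g i) + (1 / 4 : F) • ⁅g i, w i⁆ := by
  have : i + 1 ≠ i := by fin_cases i <;> decide
  rw [frameTriple, if_neg this, if_pos rfl]

theorem frameTriple_two (i : Fin 3) : frameTriple F g w i (i + 2) =
    -((1 / 4 : F) • ⁅g i, w i⁆) + g (i + 2) + (1 / 2 : F) • (g i + w i) := by
  have h1 : i + 2 ≠ i := by fin_cases i <;> decide
  have h2 : i + 2 ≠ i + 1 := by fin_cases i <;> decide
  rw [frameTriple, if_neg h1, if_neg h2]

theorem IsFrame.mem_adj (h : IsFrame F g w) : g ∈ adj F g := by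
  intro i
  have h2 := h.lie_base (i + 2)
  rw [fin3_two_one, ← lie_skew] at h2
  exact ⟨lie_self _, h.lie_base i, by linear_combination (norm := module) -h2⟩

variable [CharZero F]

theorem frameTriple_one_add_two (i : Fin 3) :
    frameTriple F g w i (i + 1) + frameTriple F g w i (i + 2) = w i + g (i + 2) := by
  rw [frameTriple_one, frameTriple_two]
  module

theorem IsFrame.frameTriple_mem_adj (h : IsFrame F g w) (i : Fin 3) :
    frameTriple F g w i ∈ adj F g := by
  have hg := h.mem_adj
  have yw := h.lie_out i
  have zw := h.lie_in i
  have dg := h.dolanGrady i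
  have xy := adj_one hg i
  have xz := adj_two hg i
  have yx := adj_one_zero hg i
  have yz := adj_one_two hg i
  have zx := adj_two_zero hg i
  have yB : ⁅g (i + 1), ⁅g i, w i⁆⁆ = (-4 : F) • (w i + g i) := by
    rw [leibniz_lie, yx, yw]
    simp only [neg_lie, smul_lie, add_lie, lie_smul, lie_sub, yw, xy]
    module
  have zB : ⁅g (i + 2), ⁅g i, w i⁆⁆ = (4 : F) • (g i - w i) := by
    rw [leibniz_lie, zx, zw]
    simp only [lie_neg, smul_lie, add_lie, lie_smul, lie_add, zw, xz]
    module
  have yC : ⁅g (i + 1), ⁅g i, ⁅g i, w i⁆⁆⁆ = (-2 : F) • ⁅g i, ⁅g i, w i⁆⁆ - (4 : F) • ⁅g i, w i⁆ +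
      (8 : F) • (w i + g i) := by
    rw [leibniz_lie, yx, yB]
    simp only [neg_lie, smul_lie, add_lie, lie_smul, lie_add, yB, lie_self]
    module
  have zC : ⁅g (i + 2), ⁅g i, ⁅g i, w i⁆⁆⁆ = (2 : F) • ⁅g i, ⁅g i, w i⁆⁆ - (4 : F) • ⁅g i, w i⁆ +
      (8 : F) • (g i - w i) := by
    rw [leibniz_lie, zx, zB]
    simp only [smul_lie, add_lie, lie_smul, lie_sub, zB, lie_self]
    module
  refine fin3_forall i ?_ ?_ ?_ <;>
    simp only [fin3_one_one, fin3_one_two, fin3_two_one, fin3_two_two, frameTriple_zero,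
      frameTriple_one, frameTriple_two, lie_add, lie_sub, lie_neg, lie_smul, lie_self,
      yw, zw, dg, xz, yx, yz, zx, yB, zB, yC, zC] <;>
    refine ⟨by module, by module, by module⟩

/-- By `frameTriple_one_add_two` both arguments are an edge w plus an edge g, so only the defining
brackets enter. The result has the form required by `comm_of_lie_nilp` and also determines the
product. -/
theorem IsFrame.lie_frameTriple (h : IsFrame F g w) (i : Fin 3) :
    ⁅frameTriple F g w (i + 1) (i + 2) + frameTriple F g w (i + 1) i,
      frameTriple F g w i (i + 1) + frameTriple F g w i (i + 2)⁆ =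
      (-4 : F) • (frameTriple F g w i - g) (i + 2) := by
  have e := frameTriple_one_add_two (F := F) (g := g) (w := w) i
  have e' := frameTriple_one_add_two (F := F) (g := g) (w := w) (i + 1)
  rw [fin3_one_one, fin3_one_two] at e'
  have zw := h.lie_out (i + 1)
  rw [fin3_one_one, ← lie_skew] at zw
  rw [e, e', Pi.sub_apply, frameTriple_two]
  simp only [lie_add, add_lie, h.lie_apex, adj_two h.mem_adj]
  linear_combination (norm := module) -zw

theorem IsFrame.comm_frameTriple (h : IsFrame F g w) (i : Fin 3) :
    Comm (frameTriple F g w (i + 1)) (frameTriple F g w i) := by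
  refine comm_of_lie_nilp h.mem_adj (h.frameTriple_mem_adj _) (h.frameTriple_mem_adj _)
    (sub_mem (h.frameTriple_mem_adj i) h.mem_adj) (i + 2) ?_
  rw [fin3_two_one, fin3_two_two, h.lie_frameTriple i]

theorem IsFrame.mul_frameTriple (h : IsFrame F g w) (i : Fin 3) :
    mul F (frameTriple F g w (i + 1)) (frameTriple F g w i) = frameTriple F g w i - g := by
  have e := h.lie_frameTriple i
  have hc := h.comm_frameTriple i
  have hT := h.frameTriple_mem_adj i
  have hT' := h.frameTriple_mem_adj (i + 1)
  refine adj_ext (mul_mem_adj hT' hT hc) (sub_mem hT h.mem_adj) (i + 2) ?_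
  have e' := lie_nilp_nilp hT' hT hc (i + 2)
  rw [fin3_two_one, fin3_two_two, e] at e'
  linear_combination (norm := module) (1 / 4 : F) • e'

/-- This is the content of the Dolan-Grady relation for ad (w i): expanded in entries of t and q =
t², it reduces to this one bracket once the action of g is used. It supplies the hypothesis `hk` of
`powComm`. -/
theorem IsFrame.lie_sq_frameTriple (h : IsFrame F g w) (i : Fin 3) :
    ⁅mul F (frameTriple F g w i) (frameTriple F g w i) (i + 1) +
      mul F (frameTriple F g w i) (frameTriple F g w i) (i + 2),
      frameTriple F g w i (i + 1) + frameTriple F g w i (i + 2)⁆ = 0 := by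
  have hg := h.mem_adj
  have hT := h.frameTriple_mem_adj i
  have hw : w i = frameTriple F g w i (i + 1) + frameTriple F g w i (i + 2) - g (i + 2) := by
    rw [frameTriple_one_add_two, add_sub_cancel_right]
  have dg := h.dolanGrady_apex i
  set t := frameTriple F g w i with ht
  have hq := mul_mem_adj hT hT (Comm.refl t)
  set q := mul F t t with hq'
  have tt : ⁅t (i + 1), t (i + 2)⁆ = (2 : F) • (q (i + 1) + q (i + 2)) := by
    have := lie_succ (F := F) t t (i + 1)
    rwa [fin3_one_one] at this
  have tt' : ⁅t (i + 2), t (i + 1)⁆ = -((2 : F) • (q (i + 1) + q (i + 2))) := by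
    rw [← lie_skew, tt]
  have tx1 : ⁅t (i + 1), g i⁆ = -((2 : F) • (t i + t (i + 1))) := by
    rw [← lie_skew, adj_one hT]
  have tx2 : ⁅t (i + 2), g i⁆ = (2 : F) • (t (i + 2) + t i) := by
    rw [← lie_skew, adj_two hT, neg_neg]
  have tz1 : ⁅t (i + 1), g (i + 2)⁆ = (2 : F) • (t (i + 1) + t (i + 2)) := by
    rw [← lie_skew, adj_two_one hT, neg_neg]
  have tz2 : ⁅t (i + 2), g (i + 2)⁆ = 0 := by
    rw [← lie_skew, adj_zero hT, neg_zero]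
  have d1 : ⁅w i, g i⁆ = (2 : F) • (t (i + 2) - t (i + 1) - g (i + 2) - g i) := by
    rw [hw]
    simp only [sub_lie, add_lie, tx1, tx2, adj_two_zero hg]
    module
  have d2 : ⁅w i, ⁅w i, g i⁆⁆ = (8 : F) • (q (i + 1) + q (i + 2)) - (4 : F) • t (i + 1) -
      (12 : F) • t (i + 2) + (4 : F) • (g (i + 2) + g i) := by
    rw [d1, hw]
    simp only [lie_smul, lie_sub, sub_lie, add_lie, tx1, tx2, tz1, tz2, tt, tt', lie_self,
      adj_two_zero hg, adj_zero hT, adj_two_one hT]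
    module
  rw [d2, d1, hw] at dg
  simp only [lie_smul, lie_sub, lie_add, sub_lie, add_lie, tx1, tx2, tz1, tz2, tt, tt', lie_self,
    adj_two_zero hg, adj_zero hT, adj_two_one hT, adj_zero hq, adj_two_one hq] at dg
  rw [← lie_skew]
  simp only [lie_add, add_lie]
  linear_combination (norm := module) (-1 / 8 : F) • dg

theorem IsFrame.exists_isCoordAlgebra (h : IsFrame F g w) :
    ∃ J : Submodule F (Fin 3 → L), IsCoordAlgebra g J ∧ ∀ i, frameTriple F g w i ∈ J := by
  refine Tetrahedron.exists_isCoordAlgebra h.mem_adj h.frameTriple_mem_adj (fun i N => ?_)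
    h.comm_frameTriple h.mul_frameTriple
  refine powComm h.mem_adj (h.frameTriple_mem_adj i) (i + 2) ?_ N
  rw [fin3_two_two]
  exact h.lie_sq_frameTriple i

end Frames

/-! ### The decomposition sl₂ ⊗ J and centralizers of edges. -/

section Structure

variable {F : Type*} {L : Type*} [Field F] [CharZero F] [LieRing L] [LieAlgebra F L]
variable {g w : Fin 3 → L} {J : Submodule F (Fin 3 → L)}

theorem IsCoordAlgebra.mul_comm (hJ : IsCoordAlgebra g J) {a b : Fin 3 → L} (ha : a ∈ J)
    (hb : b ∈ J) : mul F a b = mul F b a :=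
  mul_comm_of_comm (hJ.le ha) (hJ.le hb) (hJ.comm a ha b hb)

theorem IsCoordAlgebra.mul_assoc (hJ : IsCoordAlgebra g J) {a b c : Fin 3 → L} (ha : a ∈ J)
    (hb : b ∈ J) (hc : c ∈ J) : mul F (mul F a b) c = mul F a (mul F b c) :=
  (Comm.mul_comm_and_assoc (hJ.le ha) (hJ.le hb) (hJ.le hc) (hJ.comm a ha b hb)
    (hJ.comm a ha c hc) (hJ.comm b hb c hc) (hJ.comm a ha _ (hJ.mul_mem b hb c hc))
    (hJ.comm b hb _ (hJ.mul_mem a ha c hc))).2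

theorem IsCoordAlgebra.lie_succ_left (hJ : IsCoordAlgebra g J) {a b : Fin 3 → L} (ha : a ∈ J)
    (hb : b ∈ J) (i : Fin 3) :
    ⁅a (i + 1), b i⁆ = -((2 : F) • (mul F a b i + mul F a b (i + 1))) := by
  rw [(hJ.comm a ha b hb).skew (hJ.le ha) (hJ.le hb), lie_succ (F := F)]

/-- The Lie subalgebra of all entries of triples of `J`. -/
def IsCoordAlgebra.lieSubalgebra (hJ : IsCoordAlgebra g J) : LieSubalgebra F L where
  toSubmodule := ⨆ i, J.map (LinearMap.proj i)
  lie_mem' := by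
    have mem : ∀ a ∈ J, ∀ i, a i ∈ ⨆ i, J.map (LinearMap.proj (R := F) (φ := fun _ => L) i) :=
      fun a ha i => Submodule.mem_iSup_of_mem i ⟨a, ha, rfl⟩
    intro u v hu hv
    change u ∈ ⨆ i, J.map (LinearMap.proj i) at hu
    change v ∈ ⨆ i, J.map (LinearMap.proj i) at hv
    change ⁅u, v⁆ ∈ ⨆ i, J.map (LinearMap.proj i)
    induction hu using Submodule.iSup_induction' with
    | mem i u hu =>
      obtain ⟨a, ha, rfl⟩ := hu
      induction hv using Submodule.iSup_induction' with
      | mem j v hv =>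
        obtain ⟨b, hb, rfl⟩ := hv
        change ⁅a i, b j⁆ ∈ _
        have hab := hJ.mul_mem a ha b hb
        revert j
        refine fin3_forall i ?_ ?_ ?_
        · rw [hJ.comm a ha b hb]
          exact zero_mem _
        · rw [lie_succ (F := F)]
          exact Submodule.smul_mem _ _ (add_mem (mem _ hab _) (mem _ hab _))
        · have e := hJ.lie_succ_left ha hb (i + 2)
          rw [fin3_two_one] at e
          rw [e]
          exact neg_mem (Submodule.smul_mem _ _ (add_mem (mem _ hab _) (mem _ hab _)))
      | zero => rw [lie_zero]; exact zero_mem _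
      | add v v' _ _ h h' => rw [lie_add]; exact add_mem h h'
    | zero => rw [zero_lie]; exact zero_mem _
    | add u u' _ _ h h' => rw [add_lie]; exact add_mem h h'

theorem IsCoordAlgebra.mem_lieSubalgebra (hJ : IsCoordAlgebra g J) {a : Fin 3 → L} (ha : a ∈ J)
    (i : Fin 3) : a i ∈ hJ.lieSubalgebra :=
  Submodule.mem_iSup_of_mem (p := fun i => J.map (LinearMap.proj (R := F) (φ := fun _ => L) i)) i
    ⟨a, ha, rfl⟩

theorem IsCoordAlgebra.exists_eq_add (hJ : IsCoordAlgebra g J) (i : Fin 3) {v : L}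
    (hv : v ∈ hJ.lieSubalgebra) :
    ∃ a ∈ J, ∃ b ∈ J, ∃ c ∈ J, v = a i + b (i + 1) + c (i + 2) := by
  change v ∈ ⨆ i, J.map (LinearMap.proj i) at hv
  induction hv using Submodule.iSup_induction' with
  | mem j v hv =>
    obtain ⟨a, ha, rfl⟩ := hv
    revert j
    refine fin3_forall i ?_ ?_ ?_
    · exact ⟨a, ha, 0, zero_mem _, 0, zero_mem _, by simp⟩
    · exact ⟨0, zero_mem _, a, ha, 0, zero_mem _, by simp⟩
    · exact ⟨0, zero_mem _, 0, zero_mem _, a, ha, by simp⟩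
  | zero => exact ⟨0, zero_mem _, 0, zero_mem _, 0, zero_mem _, by simp⟩
  | add v v' _ _ h h' =>
    obtain ⟨a, ha, b, hb, c, hc, rfl⟩ := h
    obtain ⟨a', ha', b', hb', c', hc', rfl⟩ := h'
    refine ⟨_, add_mem ha ha', _, add_mem hb hb', _, add_mem hc hc', ?_⟩
    simp only [Pi.add_apply]
    abel

theorem eq_zero_of_add_succ {b : Fin 3 → L} (hb : b ∈ adj F g) (i : Fin 3)
    (h : b i + b (i + 1) = 0) : b = 0 := by
  have e : ⁅g (i + 2), b i + b (i + 1)⁆ = 0 := by rw [h, lie_zero]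
  rw [lie_add, adj_two_zero hb, adj_two_one hb] at e
  refine adj_ext hb (zero_mem _) i ?_
  rw [Pi.zero_apply]
  linear_combination (norm := module) (1 / 4 : F) • e + (1 / 2 : F) • h

/-- The first and second powers of ad g i separate the weight 2 part, which carries b, from the
weight -2 part, which carries c. -/
theorem eq_zero_of_lie_eq_zero {a b c : Fin 3 → L} (ha : a ∈ adj F g) (hb : b ∈ adj F g)
    (hc : c ∈ adj F g) (i : Fin 3) (h : ⁅g i, a i + b (i + 1) + c (i + 2)⁆ = 0) :
    b = 0 ∧ c = 0 := by
  have e := lie_lie_add_add ha hb hc i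
  rw [h, lie_zero] at e
  rw [lie_add_add ha hb hc] at h
  refine ⟨eq_zero_of_add_succ hb i ?_, eq_zero_of_add_succ hc (i + 2) ?_⟩
  · linear_combination (norm := module) (1 / 4 : F) • h - (1 / 8 : F) • e
  · rw [fin3_two_one]
    linear_combination (norm := module) (-1 / 4 : F) • h - (1 / 8 : F) • e

theorem eq_zero_of_add_eq_zero {a b c : Fin 3 → L} (ha : a ∈ adj F g) (hb : b ∈ adj F g)
    (hc : c ∈ adj F g) (i : Fin 3) (h : a i + b (i + 1) + c (i + 2) = 0) :
    a = 0 ∧ b = 0 ∧ c = 0 := by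
  obtain ⟨rfl, rfl⟩ := eq_zero_of_lie_eq_zero ha hb hc i (by rw [h, lie_zero])
  refine ⟨adj_ext ha (zero_mem _) i ?_, rfl, rfl⟩
  simpa using h

theorem IsCoordAlgebra.lieSubalgebra_eq_top (hJ : IsCoordAlgebra g J)
    (hT : ∀ i, frameTriple F g w i ∈ J)
    (hgen : ∀ K : LieSubalgebra F L, (∀ i, g i ∈ K) → (∀ i, w i ∈ K) → K = ⊤) :
    hJ.lieSubalgebra = ⊤ := by
  refine hgen _ (hJ.mem_lieSubalgebra hJ.one_mem) fun i => ?_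
  rw [show w i = frameTriple F g w i (i + 1) + frameTriple F g w i (i + 2) - g (i + 2) by
    rw [frameTriple_one_add_two, add_sub_cancel_right]]
  exact sub_mem (add_mem (hJ.mem_lieSubalgebra (hT i) _) (hJ.mem_lieSubalgebra (hT i) _))
    (hJ.mem_lieSubalgebra hJ.one_mem _)

/-- On sl₂ ⊗ J, ad g i is annihilated by X(X - 2)(X + 2) = X³ - 4X. -/
theorem IsFrame.lie_lie_lie (h : IsFrame F g w)
    (hgen : ∀ K : LieSubalgebra F L, (∀ i, g i ∈ K) → (∀ i, w i ∈ K) → K = ⊤) (i : Fin 3) (v : L) :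
    ⁅g i, ⁅g i, ⁅g i, v⁆⁆⁆ = (4 : F) • ⁅g i, v⁆ := by
  obtain ⟨J, hJ, hT⟩ := h.exists_isCoordAlgebra
  obtain ⟨a, ha, b, hb, c, hc, rfl⟩ := hJ.exists_eq_add i
    (show v ∈ hJ.lieSubalgebra by rw [hJ.lieSubalgebra_eq_top hT hgen]; trivial)
  rw [lie_lie_add_add (hJ.le ha) (hJ.le hb) (hJ.le hc),
    lie_add_add (hJ.le ha) (hJ.le hb) (hJ.le hc)]
  simp only [lie_smul, lie_add, adj_zero (hJ.le hb), adj_one (hJ.le hb), adj_zero (hJ.le hc),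
    adj_two (hJ.le hc)]
  module

/-- The algebra is the direct sum of the centralizers of three consecutive edges of a path:
`g i`, `g (i + 1)` and `w i`. -/
theorem IsFrame.centralizers (h : IsFrame F g w)
    (hgen : ∀ K : LieSubalgebra F L, (∀ i, g i ∈ K) → (∀ i, w i ∈ K) → K = ⊤) (i : Fin 3) :
    (∀ v : L, ∃ v0 v1 v2 : L, ⁅g i, v0⁆ = 0 ∧ ⁅g (i + 1), v1⁆ = 0 ∧ ⁅w i, v2⁆ = 0 ∧
      v0 + v1 + v2 = v) ∧
    ∀ v0 v1 v2 : L, ⁅g i, v0⁆ = 0 → ⁅g (i + 1), v1⁆ = 0 → ⁅w i, v2⁆ = 0 → v0 + v1 + v2 = 0 →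
      v0 = 0 ∧ v1 = 0 ∧ v2 = 0 := by
  obtain ⟨J, hJ, hT⟩ := h.exists_isCoordAlgebra
  have htop := hJ.lieSubalgebra_eq_top hT hgen
  have hdec : ∀ i (v : L), ∃ a ∈ J, ∃ b ∈ J, ∃ c ∈ J, v = a i + b (i + 1) + c (i + 2) :=
    fun i v => hJ.exists_eq_add i (by rw [htop]; trivial)
  have hcent : ∀ i (v : L), ⁅g i, v⁆ = 0 → ∃ a ∈ J, v = a i := by
    intro i v hv
    obtain ⟨a, ha, b, hb, c, hc, rfl⟩ := hdec i v
    obtain ⟨rfl, rfl⟩ := eq_zero_of_lie_eq_zero (hJ.le ha) (hJ.le hb) (hJ.le hc) i hv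
    exact ⟨a, ha, by simp⟩
  have hm := h.mul_frameTriple (i + 2)
  rw [fin3_two_one] at hm
  have hw := frameTriple_one_add_two (F := F) (g := g) (w := w) i
  have ht := hT i
  have hr := neg_mem (hT (i + 2))
  set t := frameTriple F g w i
  have hu : t - g ∈ J := sub_mem ht hJ.one_mem
  obtain ⟨u, hut⟩ : ∃ u, u = t - g := ⟨_, rfl⟩
  rw [← hut] at hu
  replace hw : w i = t (i + 1) + u (i + 2) := by
    rw [hut, Pi.sub_apply]
    linear_combination (norm := module) -hw
  -- r is the inverse of u = T i - 1, because T i · T (i + 2) = T (i + 2) - 1.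
  obtain ⟨r, hrT⟩ : ∃ r, r = -frameTriple F g w (i + 2) := ⟨_, rfl⟩
  rw [← hrT] at hr
  have hur : mul F u r = g := by
    rw [hut, hrT, map_neg, map_sub, LinearMap.sub_apply, hm,
      one_mul_of_mem (h.frameTriple_mem_adj _)]
    abel
  have hru : mul F r u = g := by rw [hJ.mul_comm hr hu, hur]
  constructor
  · intro v
    obtain ⟨a, ha, b, hb, c, hc, rfl⟩ := hdec i v
    -- With d = c/u, the element w i ⊗ d = g (i + 1) ⊗ td + g (i + 2) ⊗ c commutes with w i and has
    -- the required last component; the rest is corrected within the centralizer of g (i + 1).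
    set d := mul F r c with hd'
    have hd : d ∈ J := hJ.mul_mem r hr c hc
    have hud : mul F u d = c := by
      rw [hd', ← hJ.mul_assoc hu hr hc, hur, one_mul_of_mem (hJ.le hc)]
    have htd := hJ.mul_mem t ht d hd
    have hcomm : mul F u (mul F t d) = mul F t c := by
      rw [← hJ.mul_assoc hu ht hd, hJ.mul_comm hu ht, hJ.mul_assoc ht hu hd, hud]
    refine ⟨a i, b (i + 1) - mul F t d (i + 1), mul F t d (i + 1) + c (i + 2),
      adj_zero (hJ.le ha) i, ?_, ?_, by abel⟩
    · rw [lie_sub, adj_zero (hJ.le hb), adj_zero (hJ.le htd), sub_zero]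
    · have e1 := lie_succ (F := F) t c (i + 1)
      have e2 := hJ.lie_succ_left hu htd (i + 1)
      rw [fin3_one_one] at e1 e2
      rw [hw, lie_add, add_lie, add_lie, e1, e2, hcomm, hJ.comm t ht _ htd, hJ.comm u hu c hc]
      module
  · intro v0 v1 v2 h0 h1 h2 hsum
    obtain ⟨a, ha, rfl⟩ := hcent i v0 h0
    obtain ⟨b, hb, rfl⟩ := hcent (i + 1) v1 h1
    have e1 := hJ.lie_succ_left ht ha i
    have e2 := lie_succ (F := F) u a (i + 2)
    have e3 := hJ.lie_succ_left hu hb (i + 1)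
    rw [fin3_two_one] at e2
    rw [fin3_one_one] at e3
    have hta : mul F t a = mul F u a + a := by
      rw [hut, map_sub, LinearMap.sub_apply, one_mul_of_mem (hJ.le ha), sub_add_cancel]
    have hub := hJ.mul_mem u hu b hb
    have hua := hJ.mul_mem u hu a ha
    -- Since t = u + 1, the component of this bracket along g i is -2a, so a = 0. The component
    -- along g (i + 2) then gives ub = 0, and u is invertible.
    have e : ⁅w i, a i + b (i + 1)⁆ = 0 := by
      rw [show a i + b (i + 1) = -v2 by linear_combination (norm := module) hsum, lie_neg, h2,
        neg_zero]
    rw [hw, lie_add, add_lie, add_lie, e1, e2, e3, hJ.comm t ht b hb, hta] at e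
    obtain ⟨ha0, -, hub0⟩ := eq_zero_of_add_eq_zero (hJ.le ha)
      (a := a) (b := mul F u a + a + mul F u b) (c := mul F u b - mul F u a)
      (add_mem (add_mem (hJ.le hua) (hJ.le ha)) (hJ.le hub)) (sub_mem (hJ.le hub) (hJ.le hua)) i (by
        simp only [Pi.add_apply, Pi.sub_apply] at e ⊢
        linear_combination (norm := module) (-1 / 2 : F) • e)
    subst ha0
    rw [map_zero, sub_zero] at hub0
    have hb0 : b = 0 := by
      rw [← one_mul_of_mem (hJ.le hb), ← hru, hJ.mul_assoc hr hu hb, hub0, map_zero]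
    subst hb0
    simpa using hsum

end Structure

/-! ### Transfer to the presented algebra. -/

section Presentation

variable (F : Type*) [Field F]

/-- The quotient map onto the tetrahedron algebra. -/
noncomputable def mkHom : FreeLieAlgebra F Gen →ₗ⁅F⁆ TetAlg F where
  toLinearMap := (relIdeal F).toSubmodule.mkQ
  map_lie' := fun {a b} => LieSubmodule.Quotient.mk_bracket (I := relIdeal F) a b

theorem mkHom_surjective : Function.Surjective (mkHom F) :=
  Submodule.mkQ_surjective _

theorem mkHom_freeGen (i j : Fin 4) (hij : i ≠ j) : mkHom F (freeGen F i j hij) = x F i j hij :=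
  rfl

theorem mkHom_eq_zero {r : FreeLieAlgebra F Gen} (h : IsRelator F r) : mkHom F r = 0 :=
  (Submodule.Quotient.mk_eq_zero _).mpr (LieSubmodule.subset_lieSpan h)

theorem x_swap {i j : Fin 4} (hij : i ≠ j) : x F j i hij.symm = -x F i j hij := by
  have h := mkHom_eq_zero F (IsRelator.add_swap i j hij)
  rw [map_add, mkHom_freeGen, mkHom_freeGen] at h
  exact (neg_eq_of_add_eq_zero_right h).symm

theorem lie_x_x {i j k : Fin 4} (hij : i ≠ j) (hjk : j ≠ k) (hik : i ≠ k) :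
    ⁅x F i j hij, x F j k hjk⁆ = (2 : F) • (x F i j hij + x F j k hjk) := by
  have h := mkHom_eq_zero F (IsRelator.bracket i j k hij hjk hik)
  rw [map_sub, LieHom.map_lie, map_add, map_smul, map_smul, mkHom_freeGen, mkHom_freeGen] at h
  rw [sub_eq_zero.mp h, smul_add]

theorem dolanGrady_x {h i j k : Fin 4} (hhi : h ≠ i) (hhj : h ≠ j) (hkh : k ≠ h)
    (hij : i ≠ j) (hik : i ≠ k) (hjk : j ≠ k) :
    ⁅x F i j hij, ⁅x F i j hij, ⁅x F i j hij, x F k h hkh⁆⁆⁆ =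
      (4 : F) • ⁅x F i j hij, x F k h hkh⁆ := by
  have e := mkHom_eq_zero F (IsRelator.dolanGrady h i j k hhi hhj hkh hij hik hjk)
  rw [map_sub, map_smul] at e
  simp only [LieHom.map_lie, mkHom_freeGen] at e
  exact sub_eq_zero.mp e

theorem lieSubalgebra_eq_top {K : LieSubalgebra F (TetAlg F)}
    (h : ∀ (i j : Fin 4) (hij : i ≠ j), x F i j hij ∈ K) : K = ⊤ := by
  let φ : FreeLieAlgebra F Gen →ₗ⁅F⁆ K :=
    FreeLieAlgebra.lift F fun p : Gen => ⟨x F p.1.1 p.1.2 p.2, h _ _ p.2⟩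
  have e : K.incl.comp φ = mkHom F := by
    refine FreeLieAlgebra.hom_ext fun p => ?_
    rw [LieHom.comp_apply, FreeLieAlgebra.lift_of_apply]
    rfl
  refine eq_top_iff.mpr fun v _ => ?_
  obtain ⟨u, rfl⟩ := mkHom_surjective F v
  rw [← e]
  exact (φ u).2

variable {F} {h i j k : Fin 4}

/-- The triangle is the oriented cycle k, h, i and the apex is j. The path k, h, i, j then consists
of the edges g 0, g 1 and, up to sign, w 0. -/
theorem isFrame (hhi : h ≠ i) (hhj : h ≠ j) (hkh : k ≠ h) (hij : i ≠ j) (hik : i ≠ k)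
    (hjk : j ≠ k) :
    IsFrame F ![x F k h hkh, x F h i hhi, x F i k hik]
      ![x F j i hij.symm, x F j k hjk, x F j h hhj.symm] := by
  have out : ∀ {a b c : Fin 4} (hab : a ≠ b) (hbc : b ≠ c) (hac : a ≠ c),
      ⁅x F a b hab, x F c b hbc.symm⁆ = (2 : F) • (x F c b hbc.symm - x F a b hab) :=
    fun hab hbc hac => by
      rw [x_swap F hbc, lie_neg, lie_x_x F hab hbc hac]
      module
  have into : ∀ {a b c : Fin 4} (hab : a ≠ b) (hbc : b ≠ c) (hac : a ≠ c),
      ⁅x F a b hab, x F c a hac.symm⁆ = -((2 : F) • (x F c a hac.symm + x F a b hab)) :=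
    fun hab hbc hac => by
      rw [← lie_skew, lie_x_x F hac.symm hab hbc.symm]
  have apex : ∀ {a b c : Fin 4} (hab : a ≠ b) (hbc : b ≠ c) (hac : a ≠ c),
      ⁅x F a b hab, x F a c hac⁆ = (2 : F) • (x F a b hab - x F a c hac) :=
    fun hab hbc hac => by
      rw [x_swap F hab.symm, neg_lie, lie_x_x F hab.symm hac hbc]
      module
  constructor <;> intro a <;> fin_cases a
  · exact lie_x_x F hkh hhi hik.symm
  · exact lie_x_x F hhi hik hkh.symm
  · exact lie_x_x F hik hkh hhi.symm
  · exact out hhi hij hhj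
  · exact out hik hjk.symm hij
  · exact out hkh hhj hjk.symm
  · exact into hik hjk.symm hij
  · exact into hkh hhj hjk.symm
  · exact into hhi hij hhj
  · exact apex hjk hik.symm hij.symm
  · exact apex hhj.symm hkh.symm hjk
  · exact apex hij.symm hhi.symm hhj.symm
  · exact dolanGrady_x F hik hhi.symm hij.symm hkh hjk.symm hhj
  · exact dolanGrady_x F hkh hik.symm hjk hhi hhj hij
  · exact dolanGrady_x F hhi hkh.symm hhj.symm hik hij hjk.symm
  · exact dolanGrady_x F hhj hhi hkh hij.symm hjk hik
  · exact dolanGrady_x F hij hik hhi hjk hhj.symm hkh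
  · exact dolanGrady_x F hjk.symm hkh hik hhj.symm hij.symm hhi

theorem eq_top_of_frame (hhi : h ≠ i) (hhj : h ≠ j) (hkh : k ≠ h) (hij : i ≠ j) (hik : i ≠ k)
    (hjk : j ≠ k) (K : LieSubalgebra F (TetAlg F))
    (hg : ∀ a : Fin 3, (![x F k h hkh, x F h i hhi, x F i k hik] : Fin 3 → TetAlg F) a ∈ K)
    (hw : ∀ a : Fin 3,
      (![x F j i hij.symm, x F j k hjk, x F j h hhj.symm] : Fin 3 → TetAlg F) a ∈ K) :
    K = ⊤ := by
  have swap : ∀ {a b : Fin 4} (hab : a ≠ b), x F a b hab ∈ K → x F b a hab.symm ∈ K :=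
    fun hab hx => by rw [x_swap F hab]; exact neg_mem hx
  have cover : ∀ a : Fin 4, a = h ∨ a = i ∨ a = j ∨ a = k := by
    intro a
    omega
  have hkh' : x F k h hkh ∈ K := hg 0
  have hhi' : x F h i hhi ∈ K := hg 1
  have hik' : x F i k hik ∈ K := hg 2
  have hji' : x F j i hij.symm ∈ K := hw 0
  have hjk' : x F j k hjk ∈ K := hw 1
  have hjh' : x F j h hhj.symm ∈ K := hw 2
  refine lieSubalgebra_eq_top F fun a b hab => ?_
  rcases cover a with rfl | rfl | rfl | rfl <;> rcases cover b with rfl | rfl | rfl | rfl <;>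
    first
    | exact absurd rfl hab
    | assumption
    | exact swap hab.symm (by assumption)

variable [CharZero F]

theorem lie_x_lie_lie (hhi : h ≠ i) (hhj : h ≠ j) (hkh : k ≠ h) (hij : i ≠ j) (hik : i ≠ k)
    (hjk : j ≠ k) (v : TetAlg F) :
    ⁅x F k h hkh, ⁅x F k h hkh, ⁅x F k h hkh, v⁆⁆⁆ = (4 : F) • ⁅x F k h hkh, v⁆ :=
  (isFrame hhi hhj hkh hij hik hjk).lie_lie_lie
    (eq_top_of_frame hhi hhj hkh hij hik hjk) 0 v

/-- The `x i j`-like elements are the elements that commute with `x i j`. -/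
theorem mem_X_iff (hij : i ≠ j) {v : TetAlg F} : v ∈ X F i j hij ↔ ⁅x F i j hij, v⁆ = 0 :=
  ⟨fun hv => hv.1, fun hv => ⟨hv, fun _ _ hhi hhj hkh hki hkj =>
    lie_x_lie_lie hhi hhj hkh hij hki.symm hkj.symm v⟩⟩

end Presentation

/-! ### Assembly of the direct sum. -/

theorem isInternal_of_forall_add {R M : Type*} [Ring R] [AddCommGroup M] [Module R M]
    {A B C : Submodule R M} (hsum : ∀ v : M, ∃ a ∈ A, ∃ b ∈ B, ∃ c ∈ C, a + b + c = v)
    (hindep : ∀ a ∈ A, ∀ b ∈ B, ∀ c ∈ C, a + b + c = 0 → a = 0 ∧ b = 0 ∧ c = 0) :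
    DirectSum.IsInternal ![A, B, C] := by
  refine DirectSum.isInternal_submodule_of_iSupIndep_of_iSup_eq_top ?_ ?_
  · rw [iSupIndep_iff_finsetSum_eq_zero_imp_eq_zero]
    intro s v hv hsum
    have hmem : ∀ i, (if i ∈ s then v i else 0) ∈ (![A, B, C] : Fin 3 → Submodule R M) i := by
      intro i
      split_ifs with hi
      · exact hv i hi
      · exact zero_mem _
    have e : ∑ i, (if i ∈ s then v i else 0) = 0 := by
      rw [Finset.sum_ite_mem, Finset.univ_inter, hsum]
    rw [Fin.sum_univ_three] at e
    obtain ⟨h0, h1, h2⟩ := hindep _ (hmem 0) _ (hmem 1) _ (hmem 2) e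
    intro i hi
    have hall : (if i ∈ s then v i else 0) = 0 := by
      fin_cases i
      · exact h0
      · exact h1
      · exact h2
    rwa [if_pos hi] at hall
  · refine eq_top_iff.mpr fun v _ => ?_
    obtain ⟨a, ha, b, hb, c, hc, rfl⟩ := hsum v
    exact add_mem (add_mem (Submodule.mem_iSup_of_mem 0 ha) (Submodule.mem_iSup_of_mem 1 hb))
      (Submodule.mem_iSup_of_mem 2 hc)

end Tetrahedron

theorem mainTheorem1 (F : Type*) [Field F] [CharZero F]
    (h i j k : Fin 4) (hhi : h ≠ i) (hhj : h ≠ j) (hkh : k ≠ h)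
    (hij : i ≠ j) (hik : i ≠ k) (hjk : j ≠ k) :
    DirectSum.IsInternal
      ![Tetrahedron.X F k h hkh, Tetrahedron.X F h i hhi, Tetrahedron.X F i j hij] := by
  obtain ⟨h1, h2⟩ := (Tetrahedron.isFrame (F := F) hhi hhj hkh hij hik hjk).centralizers
    (Tetrahedron.eq_top_of_frame hhi hhj hkh hij hik hjk) 0
  have hswap : ∀ v, v ∈ Tetrahedron.X F i j hij ↔ ⁅Tetrahedron.x F j i hij.symm, v⁆ = 0 := by
    intro v
    rw [Tetrahedron.mem_X_iff, Tetrahedron.x_swap F hij, neg_lie, neg_eq_zero]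
  refine Tetrahedron.isInternal_of_forall_add (fun v => ?_) fun a ha b hb c hc => ?_
  · obtain ⟨a, b, c, ha, hb, hc, e⟩ := h1 v
    exact ⟨a, (Tetrahedron.mem_X_iff hkh).mpr ha, b, (Tetrahedron.mem_X_iff hhi).mpr hb, c,
      (hswap c).mpr hc, e⟩
  · exact h2 a b c ha.1 hb.1 ((hswap c).mp hc)
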